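/- Let $d\ge 1$ and let $A$ be a $d\times n$ integer matrix whose first row has all entries equal to $1$ and whose columns $a_1,\dots,a_n$ generate $\mathbb Z^d$ as a group. Let $\mathbb NA=\{\sum_j k_ja_j : k_j\in\mathbb N\}$. A face of $\mathbb NA$ is a nonempty set $\tau\subseteq\mathbb NA$ consisting of all points of $\mathbb NA$ at which some linear functional on $\mathbb R^d$ attains its minimum over $\mathbb NA$, and $\mathbb Z\tau$ denotes the subgroup of $\mathbb Z^d$ generated by $\tau$. For $\beta\in\mathbb Z^d$ let $$\nabla(\beta)=\{\tau \text{ a face of } \mathbb NA : \beta\in\mathbb NA+\mathbb Z\tau\}.$$ The sector partition is the partition of $\mathbb Z^d$ into the classes of the equivalence relation $\nabla(\beta)=\nabla(\beta')$. Let $D_n=\mathbb C\langle x_1,\dots,x_n,\partial_1,\dots,\partial_n\rangle$ be the Weyl algebra, with relations $x_ix_j=x_jx_i$, $\partial_i\partial_j=\partial_j\partial_i$, $\partial_jx_i-x_i\partial_j=\delta_{ij}$. For $\beta\in\mathbb C^d$ let $H_A(\beta)$ be the left ideal of $D_n$ generated by the toric ideal $I_A=\langle\partial^u-\partial^v : u,v\in\mathbb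 N^n,\ Au=Av\rangle\subseteq\mathbb C[\partial_1,\dots,\partial_n]$ and the operators $\sum_{j=1}^n a_{ij}x_j\partial_j-\beta_i$ for $i=1,\dots,d$, and let $M_A(\beta)=D_n/H_A(\beta)$, a left $D_n$-module. Theorem. Stratify $\mathbb Z^d$ so that $\beta$ and $\beta'$ lie in the same stratum if and only if the left $D_n$-modules $M_A(\beta)$ and $M_A(\beta')$ are isomorphic. This stratification refines the sector partition: for all $\beta,\beta'\in\mathbb Z^d$, if $M_A(\beta)\cong M_A(\beta')$ then $\nabla(\beta)=\nabla(\beta')$. -/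

import Mathlib

open scoped Pointwise

noncomputable section

namespace AHypergeometric

/-! ### The semigroup of `A`, its faces, and the sector partition -/

/-- The semigroup `ℕA ⊆ ℤ^d` of all `ℕ`-linear combinations of the columns of `A`. -/
def semigroup {d n : ℕ} (A : Matrix (Fin d) (Fin n) ℤ) : AddSubmonoid (Fin d → ℤ) :=
  AddSubmonoid.closure (Set.range A.col)

/-- `τ` is a face of `ℕA`: the (nonempty) set of points of `ℕA` at which some linear functional
on `ℝ^d` attains its minimum over `ℕA`. -/
def IsFace {d n : ℕ} (A : Matrix (Fin d) (Fin n) ℤ) (τ : Set (Fin d → ℤ)) : Prop :=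
  τ.Nonempty ∧ ∃ ℓ : Module.Dual ℝ (Fin d → ℝ),
    τ = {x | x ∈ semigroup A ∧
      ∀ y ∈ semigroup A, ℓ (fun i => (x i : ℝ)) ≤ ℓ (fun i => (y i : ℝ))}

/-- `∇(β)`: the set of faces `τ` of `ℕA` such that `β ∈ ℕA + ℤτ`. -/
def nabla {d n : ℕ} (A : Matrix (Fin d) (Fin n) ℤ) (β : Fin d → ℤ) :
    Set (Set (Fin d → ℤ)) :=
  {τ | IsFace A τ ∧
    β ∈ (semigroup A : Set (Fin d → ℤ)) + (AddSubgroup.closure τ : Set (Fin d → ℤ))}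

/-- The sector partition of `ℤ^d`, as an equivalence relation: `β ≡ β'` iff `∇(β) = ∇(β')`. -/
def sectorPartition {d n : ℕ} (A : Matrix (Fin d) (Fin n) ℤ) : Setoid (Fin d → ℤ) where
  r β β' := nabla A β = nabla A β'
  iseqv := ⟨fun _ => rfl, Eq.symm, Eq.trans⟩

/-! ### The Weyl algebra -/

/-- The defining relations of the Weyl algebra, in the free associative `ℂ`-algebra on
`x_i` (the letter `Sum.inl i`) and `∂_i` (the letter `Sum.inr i`). -/
inductive WeylRel (n : ℕ) :
    FreeAlgebra ℂ (Fin n ⊕ Fin n) → FreeAlgebra ℂ (Fin n ⊕ Fin n) → Prop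
  | x_comm (i j : Fin n) : WeylRel n
      (FreeAlgebra.ι ℂ (Sum.inl i) * FreeAlgebra.ι ℂ (Sum.inl j))
      (FreeAlgebra.ι ℂ (Sum.inl j) * FreeAlgebra.ι ℂ (Sum.inl i))
  | d_comm (i j : Fin n) : WeylRel n
      (FreeAlgebra.ι ℂ (Sum.inr i) * FreeAlgebra.ι ℂ (Sum.inr j))
      (FreeAlgebra.ι ℂ (Sum.inr j) * FreeAlgebra.ι ℂ (Sum.inr i))
  | d_x (i j : Fin n) : WeylRel n
      (FreeAlgebra.ι ℂ (Sum.inr j) * FreeAlgebra.ι ℂ (Sum.inl i))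
      (FreeAlgebra.ι ℂ (Sum.inl i) * FreeAlgebra.ι ℂ (Sum.inr j) + if i = j then 1 else 0)

/-- The Weyl algebra `D_n` over `ℂ`. -/
abbrev Weyl (n : ℕ) : Type := RingQuot (WeylRel n)

namespace Weyl

/-- The generator `x_i` of `D_n`. -/
def x {n : ℕ} (i : Fin n) : Weyl n :=
  RingQuot.mkAlgHom ℂ (WeylRel n) (FreeAlgebra.ι ℂ (Sum.inl i))

/-- The generator `∂_i` of `D_n`. -/
def del {n : ℕ} (i : Fin n) : Weyl n :=
  RingQuot.mkAlgHom ℂ (WeylRel n) (FreeAlgebra.ι ℂ (Sum.inr i))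

/-- The monomial `∂^u = ∂_1^{u_1} ⋯ ∂_n^{u_n}` of `D_n`. -/
def delPow {n : ℕ} (u : Fin n →₀ ℕ) : Weyl n :=
  (List.ofFn fun j => del j ^ u j).prod

/-- The inclusion `ℂ[∂_1, …, ∂_n] → D_n`, as the `ℂ`-linear map sending each monomial `∂^u` of
the polynomial ring to the element `∂^u` of `D_n`. -/
def ofPoly (n : ℕ) : MvPolynomial (Fin n) ℂ →ₗ[ℂ] Weyl n :=
  (MvPolynomial.basisMonomials (Fin n) ℂ).constr ℂ delPow

end Weyl

/-! ### `A`-hypergeometric systems -/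

/-- The toric ideal `I_A = ⟨∂^u - ∂^v | A u = A v⟩` of `ℂ[∂_1, …, ∂_n]`, with `u, v ∈ ℕ^n`. -/
def toricIdeal {d n : ℕ} (A : Matrix (Fin d) (Fin n) ℤ) : Ideal (MvPolynomial (Fin n) ℂ) :=
  Ideal.span {p | ∃ u v : Fin n →₀ ℕ,
    A.mulVec (fun j => (u j : ℤ)) = A.mulVec (fun j => (v j : ℤ)) ∧
      p = MvPolynomial.monomial u 1 - MvPolynomial.monomial v 1}

/-- The operator `∑_j a_{ij} x_j ∂_j - β_i`. -/
def euler {d n : ℕ} (A : Matrix (Fin d) (Fin n) ℤ) (β : Fin d → ℂ) (i : Fin d) : Weyl n :=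
  ∑ j, (A i j : ℂ) • (Weyl.x j * Weyl.del j) - algebraMap ℂ (Weyl n) (β i)

/-- The `A`-hypergeometric system `H_A(β)` with parameter `β ∈ ℂ^d`: the left ideal of `D_n`
generated by `I_A` and the operators `∑_j a_{ij} x_j ∂_j - β_i`. (Submodules of a ring over
itself are its left ideals.) -/
def system {d n : ℕ} (A : Matrix (Fin d) (Fin n) ℤ) (β : Fin d → ℂ) :
    Submodule (Weyl n) (Weyl n) :=
  Submodule.span (Weyl n)
    (Weyl.ofPoly n '' (toricIdeal A : Set (MvPolynomial (Fin n) ℂ)) ∪ Set.range (euler A β))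

/-- The `A`-hypergeometric module `M_A(β) = D_n / H_A(β)`, a left `D_n`-module. -/
abbrev hypergeometricModule {d n : ℕ} (A : Matrix (Fin d) (Fin n) ℤ) (β : Fin d → ℂ) : Type :=
  Weyl n ⧸ system A β

/-- The stratification of `ℤ^d`, as an equivalence relation, by the isomorphism class of the left
`D_n`-module `M_A(β)`. -/
def isoStratification {d n : ℕ} (A : Matrix (Fin d) (Fin n) ℤ) : Setoid (Fin d → ℤ) where
  r β β' := Nonempty (hypergeometricModule A (fun i => (β i : ℂ)) ≃ₗ[Weyl n]
    hypergeometricModule A (fun i => (β' i : ℂ)))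
  iseqv := ⟨fun _ => ⟨LinearEquiv.refl _ _⟩, fun ⟨e⟩ => ⟨e.symm⟩, fun ⟨e⟩ ⟨f⟩ => ⟨e.trans f⟩⟩

end AHypergeometric

end

/-!
For a set `J` of indices let `laurentExponents J ⊆ ℤ^n` consist of the `u` with `u j ≥ 0` for
`j ∉ J`, and let `LaurentModule J` be the space of formal sums `∑ f(u) e_u` over these exponents,
infinite sums allowed. It is a `D_n`-module under `∂_j e_u = e_{u - δ_j}` (or `0` when `u - δ_j`
is not an admissible exponent) and `x_j e_u = (u_j + 1) e_{u + δ_j}`. Thus `e_u` plays the role of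
`x^u / u!`; in the directions of `J` the module is a completed Fourier transform of a Laurent polynomial
ring, on which `∂_j` acts bijectively, so that nothing is lost at negative exponents.

A homomorphism `M_A(β) → LaurentModule J` is an element `∑ f(u) e_u` annihilated by `H_A(β)`. The
operator `∑_j a_{ij} x_j ∂_j` multiplies `e_u` by `(A u)_i`, so `f` is supported on the solutions
of `A u = β`. Conversely the sum of all `e_u` with `A u = β` is annihilated by `H_A(β)`, because
`∂^w` maps it to the corresponding sum for `β - A w`, which depends only on `A w`. Hence
`M_A(β)` has a nonzero homomorphism to `LaurentModule J` iff `β = A u` for an admissible `u`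
(`exists_ne_zero_hom_iff`).

If `J` indexes the columns lying on a face `τ`, these `β` form exactly `ℕA + ℤτ`
(`mem_semigroup_add_closure_iff`), since every point of a face is a sum of columns on that
face. Therefore `∇(β)` is determined by the isomorphism class of `M_A(β)`.
-/

namespace AHypergeometric

/-! ### The Laurent modules over the Weyl algebra -/

/-- The exponents `u ∈ ℤ^n` that are nonnegative outside `J`. -/
def laurentExponents {n : ℕ} (J : Set (Fin n)) : Set (Fin n → ℤ) :=
  {u | ∀ j ∉ J, 0 ≤ u j}

theorem add_single_mem_laurentExponents {n : ℕ} {J : Set (Fin n)} {u : Fin n → ℤ}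
    (hu : u ∈ laurentExponents J) (j : Fin n) : u + Pi.single j 1 ∈ laurentExponents J := by
  intro k hk
  have := hu k hk
  rcases eq_or_ne k j with rfl | h
  · simp; omega
  · simpa [h] using this

theorem mem_laurentExponents_of_sub_single {n : ℕ} {J : Set (Fin n)} {u : Fin n → ℤ} {j : Fin n}
    (hu : u - Pi.single j 1 ∈ laurentExponents J) : u ∈ laurentExponents J := by
  simpa using add_single_mem_laurentExponents hu j

/-- The formal sums `∑ f(u) e_u` over `u ∈ laurentExponents J`, encoded as the functions
`f : ℤ^n → ℂ` that vanish outside `laurentExponents J`. -/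
def LaurentModule {n : ℕ} (J : Set (Fin n)) : Submodule ℂ ((Fin n → ℤ) → ℂ) where
  carrier := {f | ∀ u ∉ laurentExponents J, f u = 0}
  add_mem' hf hg u hu := by simp [hf u hu, hg u hu]
  zero_mem' _ _ := rfl
  smul_mem' c f hf u hu := by simp [hf u hu]

namespace LaurentModule

variable {n : ℕ} {J : Set (Fin n)}

/-- Multiplication by `x_j`, that is, `e_u ↦ (u_j + 1) e_{u + δ_j}`. -/
def xOp (J : Set (Fin n)) (j : Fin n) : Module.End ℂ (LaurentModule J) where
  toFun f := ⟨fun u => u j * f.1 (u - Pi.single j 1), fun u hu =>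
    mul_eq_zero_of_right _ (f.2 _ fun h => hu (mem_laurentExponents_of_sub_single h))⟩
  map_add' f g := by ext u; simp [mul_add]
  map_smul' c f := by ext u; simp [mul_left_comm]

open Classical in
/-- The operator `∂_j`, that is, `e_u ↦ e_{u - δ_j}`, with `e_{u - δ_j}` read as `0` when
`u - δ_j` is not an exponent of the module. -/
noncomputable def delOp (J : Set (Fin n)) (j : Fin n) : Module.End ℂ (LaurentModule J) where
  toFun f := ⟨fun u => if u ∈ laurentExponents J then f.1 (u + Pi.single j 1) else 0,
    fun u hu => by simp [hu]⟩
  map_add' f g := by ext u; by_cases hu : u ∈ laurentExponents J <;> simp [hu]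
  map_smul' c f := by ext u; by_cases hu : u ∈ laurentExponents J <;> simp [hu]

theorem xOp_apply (j : Fin n) (f : LaurentModule J) (u : Fin n → ℤ) :
    (xOp J j f).1 u = u j * f.1 (u - Pi.single j 1) := rfl

theorem delOp_apply (j : Fin n) (f : LaurentModule J) {u : Fin n → ℤ}
    (hu : u ∈ laurentExponents J) : (delOp J j f).1 u = f.1 (u + Pi.single j 1) :=
  if_pos hu

theorem ext_of_mem {f g : LaurentModule J} (h : ∀ u ∈ laurentExponents J, f.1 u = g.1 u) :
    f = g := by
  ext u
  by_cases hu : u ∈ laurentExponents J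
  · exact h u hu
  · rw [f.2 u hu, g.2 u hu]

theorem xOp_mul_delOp_apply (i j : Fin n) (f : LaurentModule J) {u : Fin n → ℤ}
    (hu : u ∈ laurentExponents J) :
    (xOp J i (delOp J j f)).1 u = u i * f.1 (u - Pi.single i 1 + Pi.single j 1) := by
  rw [xOp_apply]
  by_cases h : u - Pi.single i 1 ∈ laurentExponents J
  · rw [delOp_apply _ _ h]
  · -- The truncation of `∂_j` is only felt where the factor `u i` vanishes.
    have hui : u i = 0 := by
      by_contra hne
      refine h fun k hk => ?_
      have := hu k hk
      rcases eq_or_ne k i with rfl | hki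
      · simp; omega
      · simpa [hki] using this
    simp [hui]

/-- The action of the Weyl algebra on `LaurentModule J`. -/
noncomputable def action (J : Set (Fin n)) : Weyl n →ₐ[ℂ] Module.End ℂ (LaurentModule J) :=
  RingQuot.liftAlgHom ℂ ⟨FreeAlgebra.lift ℂ (Sum.elim (xOp J) (delOp J)), by
    intro a b hab
    cases hab with
    | x_comm i j =>
      refine LinearMap.ext fun f => ext_of_mem fun u _ => ?_
      rcases eq_or_ne i j with rfl | h
      · rfl
      · simp [xOp_apply, h, h.symm, sub_right_comm u (Pi.single i 1), mul_left_comm]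
    | d_comm i j =>
      refine LinearMap.ext fun f => ext_of_mem fun u hu => ?_
      simp [delOp_apply, hu, add_single_mem_laurentExponents, add_right_comm u (Pi.single i 1)]
    | d_x i j =>
      refine LinearMap.ext fun f => ext_of_mem fun u hu => ?_
      rcases eq_or_ne i j with rfl | h
      · simp [delOp_apply, hu, xOp_mul_delOp_apply]
        simp [xOp_apply, add_mul]
      · simp [delOp_apply, hu, xOp_mul_delOp_apply, h]
        simp [xOp_apply, h, add_sub_right_comm]⟩

noncomputable instance : Module (Weyl n) (LaurentModule J) :=
  Module.compHom _ (action J).toRingHom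

theorem smul_def (P : Weyl n) (f : LaurentModule J) : P • f = action J P f := rfl

instance : IsScalarTower ℂ (Weyl n) (LaurentModule J) :=
  ⟨fun c P f => by simp [smul_def]⟩

theorem x_smul (j : Fin n) (f : LaurentModule J) : Weyl.x j • f = xOp J j f := by
  simp [smul_def, action, Weyl.x]

theorem del_smul (j : Fin n) (f : LaurentModule J) : Weyl.del j • f = delOp J j f := by
  simp [smul_def, action, Weyl.del]

theorem del_pow_smul_apply (j : Fin n) (k : ℕ) (f : LaurentModule J) {u : Fin n → ℤ}
    (hu : u ∈ laurentExponents J) :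
    ((Weyl.del j : Weyl n) ^ k • f).1 u = f.1 (u + Pi.single j (k : ℤ)) := by
  induction k generalizing u with
  | zero => simp
  | succ k ih =>
    rw [pow_succ', mul_smul, del_smul, delOp_apply _ _ hu,
      ih (add_single_mem_laurentExponents hu j), add_assoc, ← Pi.single_add, Nat.cast_succ,
      add_comm (1 : ℤ)]

theorem delPow_smul_apply (w : Fin n →₀ ℕ) (f : LaurentModule J) {u : Fin n → ℤ}
    (hu : u ∈ laurentExponents J) :
    (Weyl.delPow w • f).1 u = f.1 (u + fun j => (w j : ℤ)) := by
  have key (l : List (Fin n)) : ∀ u ∈ laurentExponents J,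
      ((l.map fun j => (Weyl.del j : Weyl n) ^ w j).prod • f).1 u =
        f.1 (u + (l.map fun j => Pi.single j (w j : ℤ)).sum) := by
    induction l with
    | nil => simp
    | cons j l ih =>
      intro u hu
      have hu' : u + Pi.single j (w j : ℤ) ∈ laurentExponents J := by
        intro k hk
        have := hu k hk
        rcases eq_or_ne k j with rfl | h
        · simp; omega
        · simpa [h] using this
      rw [List.map_cons, List.prod_cons, mul_smul, del_pow_smul_apply _ _ _ hu, ih _ hu',
        List.map_cons, List.sum_cons, add_assoc]
  rw [Weyl.delPow, List.ofFn_eq_map, key _ u hu, ← Fin.sum_univ_def, Finset.univ_sum_single]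

/-- The Euler operators act diagonally: `e_u` has eigenvalue `(A u)_i - β_i`. -/
theorem euler_smul_apply {d : ℕ} (A : Matrix (Fin d) (Fin n) ℤ) (β : Fin d → ℂ) (i : Fin d)
    (f : LaurentModule J) {u : Fin n → ℤ} (hu : u ∈ laurentExponents J) :
    (euler A β i • f).1 u = ((A.mulVec u i : ℤ) - β i) * f.1 u := by
  simp [euler, sub_smul, Finset.sum_smul, mul_smul, x_smul, del_smul, xOp_mul_delOp_apply, hu,
    Matrix.mulVec, dotProduct, sub_mul, Finset.sum_mul, mul_assoc]

end LaurentModule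

/-! ### Homomorphisms from hypergeometric modules to Laurent modules -/

variable {d n : ℕ} {A : Matrix (Fin d) (Fin n) ℤ}

open Classical in
/-- The formal solution `∑ e_u` of `H_A(β)`, summed over all exponents `u` with `A u = β`. -/
noncomputable def fiberSum (A : Matrix (Fin d) (Fin n) ℤ) (J : Set (Fin n)) (β : Fin d → ℤ) :
    LaurentModule J :=
  ⟨fun u => if u ∈ laurentExponents J ∧ A.mulVec u = β then 1 else 0, fun u hu => by simp [hu]⟩

theorem delPow_smul_fiberSum {J : Set (Fin n)} {β : Fin d → ℤ} (w : Fin n →₀ ℕ) :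
    Weyl.delPow w • fiberSum A J β = fiberSum A J (β - A.mulVec fun j => (w j : ℤ)) := by
  refine LaurentModule.ext_of_mem fun u hu => ?_
  have hu' : (u + fun j => (w j : ℤ)) ∈ laurentExponents J := fun k hk => by
    have := hu k hk
    simp only [Pi.add_apply]
    omega
  rw [LaurentModule.delPow_smul_apply _ _ hu]
  simp [fiberSum, hu, hu', Matrix.mulVec_add, eq_sub_iff_add_eq]

theorem ofPoly_smul_fiberSum {J : Set (Fin n)} {β : Fin d → ℤ} {p : MvPolynomial (Fin n) ℂ}
    (hp : p ∈ toricIdeal A) : Weyl.ofPoly n p • fiberSum A J β = 0 := by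
  have ofPoly_monomial (w : Fin n →₀ ℕ) (c : ℂ) :
      Weyl.ofPoly n (MvPolynomial.monomial w c) = c • Weyl.delPow w := by
    have h := (MvPolynomial.basisMonomials (Fin n) ℂ).constr_basis ℂ Weyl.delPow w
    rw [MvPolynomial.coe_basisMonomials] at h
    rw [← mul_one c, ← smul_eq_mul, ← MvPolynomial.smul_monomial, map_smul, Weyl.ofPoly, h,
      smul_eq_mul, mul_one]
  -- Quantifying over a multiplier `q` makes the property stable under multiplication by scalars
  -- of the polynomial ring, although `ofPoly` is only known to be linear.
  suffices h : ∀ q, Weyl.ofPoly n (q * p) • fiberSum A J β = 0 by simpa using h 1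
  induction hp using Submodule.span_induction with
  | mem p hp =>
    obtain ⟨u, v, huv, rfl⟩ := hp
    intro q
    induction q using MvPolynomial.induction_on' with
    | monomial w c =>
      have hw : (A.mulVec fun j => ((w + u) j : ℤ)) = A.mulVec fun j => ((w + v) j : ℤ) := by
        have add_cast (t : Fin n →₀ ℕ) : (fun j => ((w + t) j : ℤ)) =
            (fun j => (w j : ℤ)) + fun j => (t j : ℤ) := by ext; simp
        rw [add_cast, add_cast, Matrix.mulVec_add, Matrix.mulVec_add, huv]
      rw [mul_sub, MvPolynomial.monomial_mul, MvPolynomial.monomial_mul, map_sub, sub_smul,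
        ofPoly_monomial, ofPoly_monomial, smul_assoc, smul_assoc, delPow_smul_fiberSum,
        delPow_smul_fiberSum, hw, sub_self]
    | add q r hq hr => rw [add_mul, map_add, add_smul, hq, hr, add_zero]
  | zero => simp
  | add p r _ _ hp hr => intro q; rw [mul_add, map_add, add_smul, hp, hr, add_zero]
  | smul a p _ hp => intro q; rw [smul_eq_mul, ← mul_assoc, hp]

theorem exists_ne_zero_hom_iff (J : Set (Fin n)) (β : Fin d → ℤ) :
    (∃ φ : hypergeometricModule A (fun i => (β i : ℂ)) →ₗ[Weyl n] LaurentModule J, φ ≠ 0) ↔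
      ∃ u ∈ laurentExponents J, A.mulVec u = β := by
  constructor
  · rintro ⟨φ, hφ⟩
    set f := φ (Submodule.Quotient.mk 1) with hf
    have hφP (P : Weyl n) : φ (Submodule.Quotient.mk P) = P • f := by
      rw [hf, ← map_smul, ← Submodule.Quotient.mk_smul, smul_eq_mul, mul_one]
    have hf0 : f ≠ 0 := by
      intro h
      refine hφ (LinearMap.ext fun m => ?_)
      obtain ⟨P, rfl⟩ := Submodule.Quotient.mk_surjective _ m
      rw [hφP, h, smul_zero, LinearMap.zero_apply]
    obtain ⟨u, hu, hfu⟩ : ∃ u ∈ laurentExponents J, f.1 u ≠ 0 := by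
      by_contra! h
      exact hf0 (LaurentModule.ext_of_mem h)
    refine ⟨u, hu, funext fun i => ?_⟩
    have hE : euler A (fun i => (β i : ℂ)) i • f = 0 := by
      rw [← hφP, (Submodule.Quotient.mk_eq_zero _).2, map_zero]
      exact Submodule.subset_span (Or.inr ⟨i, rfl⟩)
    have h := LaurentModule.euler_smul_apply A (fun i => (β i : ℂ)) i f hu
    rw [hE] at h
    have h' := (mul_eq_zero.1 h.symm).resolve_right hfu
    exact_mod_cast sub_eq_zero.1 h'
  · rintro ⟨u, hu, hβ⟩
    have hker : system A (fun i => (β i : ℂ)) ≤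
        LinearMap.ker (LinearMap.toSpanSingleton (Weyl n) _ (fiberSum A J β)) := by
      refine Submodule.span_le.2 ?_
      rintro _ (⟨p, hp, rfl⟩ | ⟨i, rfl⟩)
      · exact ofPoly_smul_fiberSum hp
      · refine LaurentModule.ext_of_mem fun v hv => ?_
        rw [LinearMap.toSpanSingleton_apply, LaurentModule.euler_smul_apply _ _ _ _ hv]
        by_cases h : A.mulVec v = β
        · simp [h]
        · simp [fiberSum, h]
    refine ⟨Submodule.liftQ _ _ hker, fun h => ?_⟩
    have h1 := LinearMap.congr_fun h (Submodule.Quotient.mk 1)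
    rw [Submodule.liftQ_apply, LinearMap.toSpanSingleton_apply, one_smul] at h1
    have h2 : (fiberSum A J β).1 u = 0 := by rw [h1]; rfl
    simp [fiberSum, hu, hβ] at h2

/-! ### Faces of the semigroup -/

/-- The minimum of a linear functional on a face is `0`, since `ℕA` contains `0` and is closed
under doubling. -/
theorem IsFace.exists_addMonoidHom {τ : Set (Fin d → ℤ)} (hτ : IsFace A τ) :
    ∃ L : (Fin d → ℤ) →+ ℝ, (∀ y ∈ semigroup A, 0 ≤ L y) ∧
      τ = {x | x ∈ semigroup A ∧ L x = 0} := by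
  obtain ⟨⟨t, ht⟩, ℓ, hℓ⟩ := hτ
  let L : (Fin d → ℤ) →+ ℝ :=
    ℓ.toAddMonoidHom.comp ((Int.castAddHom ℝ).compLeft (Fin d))
  have hL : τ = {x | x ∈ semigroup A ∧ ∀ y ∈ semigroup A, L x ≤ L y} := hℓ
  rw [hL] at ht
  have ht0 : L t = 0 := by
    have h0 := ht.2 0 (zero_mem _)
    have h2 := ht.2 (t + t) (add_mem ht.1 ht.1)
    rw [map_zero] at h0
    rw [map_add] at h2
    linarith
  have hnonneg : ∀ y ∈ semigroup A, 0 ≤ L y := fun y hy => ht0 ▸ ht.2 y hy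
  refine ⟨L, hnonneg, ?_⟩
  rw [hL]
  ext x
  refine and_congr_right fun hx => ⟨fun h => ?_, fun h y hy => h ▸ hnonneg y hy⟩
  exact le_antisymm (ht0 ▸ h t ht.1) (hnonneg x hx)

theorem col_mem_semigroup (j : Fin n) : A.col j ∈ semigroup A :=
  AddSubmonoid.subset_closure ⟨j, rfl⟩

theorem mulVec_eq_sum_zsmul_col (u : Fin n → ℤ) : A.mulVec u = ∑ j, u j • A.col j := by
  ext i
  simp [Matrix.mulVec, dotProduct, mul_comm]

theorem exists_mulVec_eq_of_mem_semigroup {x : Fin d → ℤ} (hx : x ∈ semigroup A) :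
    ∃ k : Fin n → ℤ, (∀ j, 0 ≤ k j) ∧ A.mulVec k = x := by
  induction hx using AddSubmonoid.closure_induction with
  | mem x hx =>
    obtain ⟨j, rfl⟩ := hx
    refine ⟨Pi.single j 1, fun i => ?_, by simp⟩
    rcases eq_or_ne i j with rfl | h <;> simp [*]
  | zero => exact ⟨0, fun _ => le_rfl, Matrix.mulVec_zero A⟩
  | add x y _ _ hx hy =>
    obtain ⟨k, hk, rfl⟩ := hx
    obtain ⟨l, hl, rfl⟩ := hy
    exact ⟨k + l, fun j => add_nonneg (hk j) (hl j), Matrix.mulVec_add A k l⟩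

/-- Every element of `ℤτ` is an integral combination of the columns lying on the face `τ`. -/
theorem IsFace.exists_mulVec_eq_of_mem_closure {τ : Set (Fin d → ℤ)} (hτ : IsFace A τ)
    {t : Fin d → ℤ} (ht : t ∈ AddSubgroup.closure τ) :
    ∃ k : Fin n → ℤ, (∀ j, A.col j ∉ τ → k j = 0) ∧ A.mulVec k = t := by
  obtain ⟨L, hL, rfl⟩ := hτ.exists_addMonoidHom
  induction ht using AddSubgroup.closure_induction with
  | mem t ht =>
    obtain ⟨k, hk, rfl⟩ := exists_mulVec_eq_of_mem_semigroup ht.1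
    refine ⟨k, fun j hj => ?_, rfl⟩
    have hsum : ∑ j, (k j : ℝ) * L (A.col j) = 0 := by
      rw [← ht.2, mulVec_eq_sum_zsmul_col, map_sum]
      refine Finset.sum_congr rfl fun j _ => ?_
      rw [← zsmul_eq_mul]
      exact (map_zsmul L (k j) (A.col j)).symm
    -- A vanishing sum of nonnegative terms: columns off the face have coefficient zero.
    have hterm := (Finset.sum_eq_zero_iff_of_nonneg fun j _ =>
      mul_nonneg (Int.cast_nonneg (hk j)) (hL _ (col_mem_semigroup j))).1 hsum j
        (Finset.mem_univ j)
    have hLj : L (A.col j) ≠ 0 := fun h => hj ⟨col_mem_semigroup j, h⟩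
    exact_mod_cast (mul_eq_zero.1 hterm).resolve_right hLj
  | zero => exact ⟨0, fun _ _ => rfl, Matrix.mulVec_zero A⟩
  | add x y _ _ hx hy =>
    obtain ⟨k, hk, rfl⟩ := hx
    obtain ⟨l, hl, rfl⟩ := hy
    exact ⟨k + l, fun j hj => by simp [hk j hj, hl j hj], Matrix.mulVec_add A k l⟩
  | neg x _ hx =>
    obtain ⟨k, hk, rfl⟩ := hx
    exact ⟨-k, fun j hj => by simp [hk j hj], Matrix.mulVec_neg k A⟩

theorem mem_semigroup_add_closure_iff {τ : Set (Fin d → ℤ)} (hτ : IsFace A τ) (β : Fin d → ℤ) :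
    β ∈ (semigroup A : Set (Fin d → ℤ)) + (AddSubgroup.closure τ : Set (Fin d → ℤ)) ↔
      ∃ u ∈ laurentExponents {j | A.col j ∈ τ}, A.mulVec u = β := by
  constructor
  · rintro ⟨s, hs, t, ht, rfl⟩
    obtain ⟨k, hk, rfl⟩ := exists_mulVec_eq_of_mem_semigroup hs
    obtain ⟨l, hl, rfl⟩ := hτ.exists_mulVec_eq_of_mem_closure ht
    refine ⟨k + l, fun j hj => ?_, Matrix.mulVec_add A k l⟩
    simpa [hl j hj] using hk j
  · rintro ⟨u, hu, rfl⟩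
    suffices h : A.mulVec u ∈ semigroup A ⊔ (AddSubgroup.closure τ).toAddSubmonoid by
      obtain ⟨s, hs, t, ht, hst⟩ := AddSubmonoid.mem_sup.1 h
      exact ⟨s, hs, t, ht, hst⟩
    rw [mulVec_eq_sum_zsmul_col]
    refine sum_mem fun j _ => ?_
    by_cases hj : A.col j ∈ τ
    · exact AddSubmonoid.mem_sup_right
        (zsmul_mem (K := AddSubgroup.closure τ) (AddSubgroup.subset_closure hj) (u j))
    · obtain ⟨k, hk⟩ := Int.eq_ofNat_of_zero_le (hu j hj)
      rw [hk, natCast_zsmul]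
      exact AddSubmonoid.mem_sup_left (nsmul_mem (col_mem_semigroup j) k)

/-- The faces in `∇(β)` are detected by homomorphisms out of `M_A(β)`. -/
theorem mem_nabla_iff {β : Fin d → ℤ} {τ : Set (Fin d → ℤ)} :
    τ ∈ nabla A β ↔ IsFace A τ ∧ ∃ φ : hypergeometricModule A (fun i => (β i : ℂ)) →ₗ[Weyl n]
      LaurentModule {j | A.col j ∈ τ}, φ ≠ 0 :=
  and_congr_right fun hτ =>
    (mem_semigroup_add_closure_iff hτ β).trans (exists_ne_zero_hom_iff _ β).symm

theorem nabla_subset_of_equiv {β β' : Fin d → ℤ}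
    (e : hypergeometricModule A (fun i => (β i : ℂ)) ≃ₗ[Weyl n]
      hypergeometricModule A (fun i => (β' i : ℂ))) : nabla A β ⊆ nabla A β' := by
  intro τ hτ
  obtain ⟨hface, φ, hφ⟩ := mem_nabla_iff.1 hτ
  refine mem_nabla_iff.2 ⟨hface, φ ∘ₗ e.symm.toLinearMap, fun h => hφ ?_⟩
  ext1
  ext1
  simpa using LinearMap.congr_fun h (e (Submodule.Quotient.mk 1))

end AHypergeometric

/-- Let `A` be a `d × n` integer matrix whose first row has all entries equal to `1` and whose
columns generate `ℤ^d`. The stratification of `ℤ^d` by the isomorphism class of `M_A(β)` refines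
the sector partition, i.e. `M_A(β) ≅ M_A(β')` implies `∇(β) = ∇(β')`. -/
theorem theorem3p2 (d n : ℕ) (hd : 0 < d) (A : Matrix (Fin d) (Fin n) ℤ)
    (hrow : ∀ j : Fin n, A ⟨0, hd⟩ j = 1)
    (hcol : AddSubgroup.closure (Set.range A.col) = ⊤) :
    AHypergeometric.isoStratification A ≤ AHypergeometric.sectorPartition A ∧
      ∀ β β' : Fin d → ℤ,
        Nonempty (AHypergeometric.hypergeometricModule A (fun i => (β i : ℂ))
          ≃ₗ[AHypergeometric.Weyl n]
            AHypergeometric.hypergeometricModule A (fun i => (β' i : ℂ))) →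
        AHypergeometric.nabla A β = AHypergeometric.nabla A β' := by

  have main : ∀ β β' : Fin d → ℤ,
      Nonempty (AHypergeometric.hypergeometricModule A (fun i => (β i : ℂ))
        ≃ₗ[AHypergeometric.Weyl n]
          AHypergeometric.hypergeometricModule A (fun i => (β' i : ℂ))) →
      AHypergeometric.nabla A β = AHypergeometric.nabla A β' := fun _ _ ⟨e⟩ =>
    (AHypergeometric.nabla_subset_of_equiv e).antisymm
      (AHypergeometric.nabla_subset_of_equiv e.symm)
  exact ⟨fun {β β'} h => main β β' h, main⟩
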